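/- **Theorem 6.4.** *Notation.* For a group $G$ let $G^{(0)}=G$, $G^{(n+1)}=[G^{(n)},G^{(n)}]$ be the derived series, and let $G^{(0)}_r=G$, $G^{(k+1)}_r=\{x\in G^{(k)}_r : x^m\in[G^{(k)}_r,G^{(k)}_r]\text{ for some } m>0\}$ be the rational derived series. Put $G_k=G/G^{(k)}_r$. The integral group ring $\mathbb{Z}G_k$ is an Ore domain; let $\mathbb{K}(G_k)$ be its skew field of fractions. Group homology with coefficients in $\mathbb{Z}G_k$ is regarded as a $\mathbb{Z}G_k$-module. *Algebraic $n$-solutions.* Let $S$ be a group with $H_1(S;\mathbb{Q})\neq 0$ and let $i:F\to S$ be a homomorphism from the free group $F$ of rank $2g$. A nontrivial homomorphism $r:S\to G$ to a group $G$ is called an algebraic $n$-solution ($n\ge 0$) for $i$ if 1. for each $0\le k\le n-1$ the composition $$H_1(S;\mathbb{Z}G_k)\xrightarrow{r_*}H_1(G;\mathbb{Z}G_k)\cong G^{(k)}_r/[G^{(k)}_r,G^{(k)}_r]\twoheadrightarrow G^{(k)}_r/G^{(k+1)}_r$$ has nontrivial image after tensoring with $\mathbb{K}(G_k)$ over $\mathbb{Z}G_k$;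 2. for each $0\le k\le n$ the map $i_*:H_1(F;\mathbb{Z}G_k)\to H_1(S;\mathbb{Z}G_k)$ is surjective after tensoring with $\mathbb{K}(G_k)$ over $\mathbb{Z}G_k$. *Statement.* Let $S$ and $i:F\to S$ be as above. For each $n\ge 0$ there is a finite collection $\mathcal{P}_n$ of subsets of $F^{(n)}$, each consisting of exactly $2g-1$ elements if $n>0$ and of exactly $2g$ elements if $n=0$, with the following property. For every group $G$ and every algebraic $n$-solution $r:S\to G$ for $i$, at least one member of $\mathcal{P}_n$ maps to a generating set of the $\mathbb{K}(G_n)$-module $H_1(S;\mathbb{Z}G_n)\otimes_{\mathbb{Z}G_n}\mathbb{K}(G_n)$ under the composition $$F^{(n)}\to S^{(n)}/S^{(n+1)}\cong H_1(S;\mathbb{Z}[S/S^{(n)}])\xrightarrow{r_*}H_1(S;\mathbb{Z}G_n)\to H_1(S;\mathbb{Z}G_n)\otimes_{\mathbb{Z}G_n}\mathbb{K}(G_n).$$ The collection $\mathcal{P}_n$ depends only on $i:F\to S$ and $n$, not on $G$ or $r$. -/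

import Mathlib

noncomputable section

/-! ## The skew field of fractions of an Ore domain -/

section Fractions

open Classical in
/-- For an Ore domain `R`, the set of nonzero elements of `R`.  (In general: the non-zero-divisors
of `R` if they form an Ore set, and `{1}` otherwise, so that the definition makes sense
for all rings.) -/
def oreDenominators (R : Type*) [Ring R] : Submonoid R :=
  if Nonempty (OreLocalization.OreSet (nonZeroDivisors R)) then nonZeroDivisors R else ⊥

theorem oreDenominators_eq (R : Type*) [Ring R]
    (h : Nonempty (OreLocalization.OreSet (nonZeroDivisors R))) :
    oreDenominators R = nonZeroDivisors R :=
  if_pos h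

theorem mem_oreDenominators_iff (R : Type*) [Ring R] [IsDomain R]
    (h : Nonempty (OreLocalization.OreSet (nonZeroDivisors R))) (x : R) :
    x ∈ oreDenominators R ↔ x ≠ 0 := by
  rw [oreDenominators_eq R h, mem_nonZeroDivisors_iff_ne_zero]

instance oreDenominators.oreSet (R : Type*) [Ring R] :
    OreLocalization.OreSet (oreDenominators R) :=
  Classical.choice <| by
    unfold oreDenominators
    split_ifs with h
    · exact h
    · exact ⟨OreLocalization.oreSetBot⟩

/-- The classical ring of quotients of `R`; for an Ore domain `R` (such as the integral group
ring of a poly-(torsion-free-abelian) group) this is its skew field of fractions. -/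
abbrev OreFractionRing (R : Type*) [Ring R] : Type _ :=
  OreLocalization (oreDenominators R) R

variable {R : Type*} [Ring R] {M N : Type*} [AddCommGroup M] [Module R M]
  [AddCommGroup N] [Module R N]

/-- The module of fractions of `M`, with elements `s⁻¹ m`: this is `K ⊗_R M`, with
`K = OreFractionRing R`. -/
abbrev OreFractionModule (R : Type*) [Ring R] (M : Type*) [AddCommGroup M] [Module R M] : Type _ :=
  OreLocalization (oreDenominators R) M

/-- The canonical map `M → K ⊗_R M`, `m ↦ 1 ⊗ m`. -/
def OreFractionModule.mk (R : Type*) [Ring R] {M : Type*} [AddCommGroup M] [Module R M] (m : M) :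
    OreFractionModule R M :=
  OreLocalization.oreDiv m (1 : oreDenominators R)

/-- The map `id ⊗ f : K ⊗_R M → K ⊗_R N`, `s⁻¹ m ↦ s⁻¹ f(m)`, induced by an `R`-linear map. -/
def OreFractionModule.map (f : M →ₗ[R] N) :
    OreFractionModule R M →ₗ[OreFractionRing R] OreFractionModule R N where
  toFun := OreLocalization.liftExpand (fun m s => OreLocalization.oreDiv (f m) s)
    (fun m t s ht => by rw [f.map_smul]; exact OreLocalization.expand (f m) s t ht)
  map_add' x y := by
    induction x using OreLocalization.ind with | _ m s
    induction y using OreLocalization.ind with | _ m' s'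
    simp only [OreLocalization.oreDiv_add_oreDiv, OreLocalization.liftExpand_of, map_add,
      map_smul, Submonoid.smul_def]
  map_smul' c x := by
    induction x using OreLocalization.ind with | _ m s
    induction c using OreLocalization.ind with | _ r t
    simp only [OreLocalization.oreDiv_smul_oreDiv, OreLocalization.liftExpand_of, map_smul,
      RingHom.id_apply]

end Fractions

/-! ## First homology of a group with twisted coefficients -/

section Homology

variable {S S' : Type*} [Group S] [Group S'] {R R' : Type*} [Ring R] [Ring R']

namespace TwistedHomology

/-- The differential `C₁ → C₀`, `a[s] ↦ a φ(s) - a`, of the bar complex `R ⊗_{ℤS} B(S)`, where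
`R` is a right `ℤS`-module through `φ`. -/
def d₁ (φ : S →* R) : (S →₀ R) →ₗ[R] R :=
  Finsupp.linearCombination R (fun s => φ s - 1)

/-- The differential `C₂ → C₁`, `a[s|t] ↦ a φ(s)[t] - a[st] + a[s]`, of the bar complex. -/
def d₂ (φ : S →* R) : (S × S →₀ R) →ₗ[R] (S →₀ R) :=
  Finsupp.linearCombination R (fun p =>
    Finsupp.single p.2 (φ p.1) - Finsupp.single (p.1 * p.2) 1 + Finsupp.single p.1 1)

theorem d₁_single (φ : S →* R) (s : S) (a : R) : d₁ φ (Finsupp.single s a) = a * φ s - a := by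
  simp [d₁, mul_sub]

theorem d₂_single (φ : S →* R) (s t : S) (a : R) : d₂ φ (Finsupp.single (s, t) a) =
    Finsupp.single t (a * φ s) - Finsupp.single (s * t) a + Finsupp.single s a := by
  simp [d₂, smul_sub, smul_add]

theorem d₁_comp_d₂ (φ : S →* R) : d₁ φ ∘ₗ d₂ φ = 0 := by
  ext ⟨s, t⟩
  simp [d₁_single, d₂_single]

end TwistedHomology

open TwistedHomology

/-- The 1-chains modulo boundaries, `C₁ / d₂(C₂)`. -/
abbrev ChainsModBoundaries (φ : S →* R) : Type _ :=
  (S →₀ R) ⧸ LinearMap.range (d₂ φ)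

/-- The map `C₁ / d₂(C₂) → C₀` induced by the differential `d₁`. -/
def ChainsModBoundaries.d (φ : S →* R) : ChainsModBoundaries φ →ₗ[R] R :=
  (LinearMap.range (d₂ φ)).liftQ (d₁ φ) (by
    rintro _ ⟨y, rfl⟩
    exact DFunLike.congr_fun (d₁_comp_d₂ φ) y)

/-- `H₁(S; R)`, the first homology of the group `S` with coefficients in the ring `R`, on which `S`
acts through `φ : S → R`: the cycles `ker d₁` modulo the boundaries `d₂(C₂)`, as a submodule of
`C₁ / d₂(C₂)`.  It is a (left) `R`-module. -/
abbrev H₁ (φ : S →* R) : Type _ :=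
  LinearMap.ker (ChainsModBoundaries.d φ)

namespace H₁

/-- The class of the chain `[s]` in `C₁ / d₂(C₂)`. -/
def bracket (φ : S →* R) (s : S) : ChainsModBoundaries φ :=
  Submodule.Quotient.mk (Finsupp.single s 1)

theorem d_bracket (φ : S →* R) (s : S) :
    ChainsModBoundaries.d φ (bracket φ s) = φ s - 1 := by
  simp [ChainsModBoundaries.d, bracket, d₁_single]

theorem bracket_mul (φ : S →* R) (s t : S) :
    bracket φ (s * t) = φ s • bracket φ t + bracket φ s := by
  have : (Submodule.Quotient.mk (d₂ φ (Finsupp.single (s, t) 1)) : ChainsModBoundaries φ) = 0 :=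
    (Submodule.Quotient.mk_eq_zero _).2 ⟨_, rfl⟩
  rw [d₂_single, Submodule.Quotient.mk_add, Submodule.Quotient.mk_sub, one_mul] at this
  rw [bracket, bracket, bracket, ← Submodule.Quotient.mk_smul, Finsupp.smul_single, smul_eq_mul,
    mul_one, ← sub_eq_zero, ← neg_eq_zero, ← this]
  abel

theorem bracket_one (φ : S →* R) : bracket φ 1 = 0 := by
  have := bracket_mul φ 1 1
  simpa using this

@[ext high]
theorem hom_ext {R' : Type*} [Ring R'] {σ : R →+* R'} {P : Type*} [AddCommGroup P] [Module R' P]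
    {φ : S →* R} {f g : ChainsModBoundaries φ →ₛₗ[σ] P}
    (h : ∀ s, f (bracket φ s) = g (bracket φ s)) : f = g := by
  apply Submodule.linearMap_qext
  refine Finsupp.lhom_ext fun s a => ?_
  have e : Finsupp.single s a = a • Finsupp.single s (1 : R) := by simp
  rw [e, map_smulₛₗ, map_smulₛₗ]
  exact congrArg (σ a • ·) (h s)

/-- The class in `H₁(S; R)` of the 1-cycle `[s]`, for `s` in `S` acting trivially on `R`. -/
def ofKer (φ : S →* R) (s : S) (hs : φ s = 1) : H₁ φ :=
  ⟨bracket φ s, by simp [d_bracket, hs]⟩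

/-- The map `C₁ / d₂(C₂) → C₁' / d₂(C₂')`, `a[s] ↦ σ(a)[f(s)]`, induced by compatible homomorphisms
`f : S → S'` of groups and `σ : R → R'` of coefficient rings. -/
def chainMap (f : S →* S') (σ : R →+* R') (φ : S →* R) (φ' : S' →* R')
    (h : ∀ s, σ (φ s) = φ' (f s)) : ChainsModBoundaries φ →ₛₗ[σ] ChainsModBoundaries φ' :=
  (LinearMap.range (d₂ φ)).liftQ
    ((LinearMap.range (d₂ φ')).mkQ.comp
      ((Finsupp.lmapDomain R' R' f).comp (Finsupp.mapRange.linearMap σ.toSemilinearMap))) (by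
    rw [LinearMap.range_le_ker_iff]
    refine Finsupp.lhom_ext fun p a => ?_
    obtain ⟨s, t⟩ := p
    rw [LinearMap.comp_apply, d₂_single, LinearMap.zero_apply, LinearMap.comp_apply,
      Submodule.mkQ_apply, Submodule.Quotient.mk_eq_zero]
    refine ⟨Finsupp.single (f s, f t) (σ a), ?_⟩
    simp only [d₂_single, LinearMap.comp_apply, map_add, map_sub]
    simp [h, -Finsupp.single_mul])

theorem chainMap_bracket (f : S →* S') (σ : R →+* R') (φ : S →* R) (φ' : S' →* R')
    (h : ∀ s, σ (φ s) = φ' (f s)) (s : S) :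
    chainMap f σ φ φ' h (bracket φ s) = bracket φ' (f s) := by
  simp [chainMap, bracket]

theorem d_chainMap (f : S →* S') (σ : R →+* R') (φ : S →* R) (φ' : S' →* R')
    (h : ∀ s, σ (φ s) = φ' (f s)) (x : ChainsModBoundaries φ) :
    ChainsModBoundaries.d φ' (chainMap f σ φ φ' h x) = σ (ChainsModBoundaries.d φ x) := by
  have : (ChainsModBoundaries.d φ').comp (chainMap f σ φ φ' h) =
      σ.toSemilinearMap.comp (ChainsModBoundaries.d φ) := by
    ext s
    simp [chainMap_bracket, d_bracket, h]
  exact DFunLike.congr_fun this x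

/-- The map `H₁(S; R) → H₁(S'; R')` induced by compatible homomorphisms `f : S → S'` of groups and
`σ : R → R'` of coefficient rings. -/
def map (f : S →* S') (σ : R →+* R') (φ : S →* R) (φ' : S' →* R')
    (h : ∀ s, σ (φ s) = φ' (f s)) : H₁ φ →ₛₗ[σ] H₁ φ' :=
  (chainMap f σ φ φ' h).restrict fun x hx => by
    rw [LinearMap.mem_ker] at hx ⊢
    rw [d_chainMap, hx, map_zero]

end H₁

end Homology

/-! ## Homology with coefficients in a group ring -/

section GroupRing

variable {S S' Γ Γ' : Type*} [Group S] [Group S'] [Group Γ] [Group Γ']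

/-- The coefficient system `S → Γ → ℤΓ` given by a homomorphism `q : S → Γ`. -/
abbrev groupRingCoeff (q : S →* Γ) : S →* MonoidAlgebra ℤ Γ :=
  (MonoidAlgebra.of ℤ Γ).comp q

/-- `H₁(S; ℤΓ)` for a homomorphism `q : S → Γ`, a module over `ℤΓ`. -/
abbrev H₁ℤ (q : S →* Γ) : Type _ :=
  H₁ (groupRingCoeff q)

/-- The map `f_* : H₁(S; ℤΓ) → H₁(S'; ℤΓ)` induced by a homomorphism `f : S → S'`. -/
def H₁ℤ.map (f : S →* S') (q : S' →* Γ) : H₁ℤ (q.comp f) →ₗ[MonoidAlgebra ℤ Γ] H₁ℤ q :=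
  H₁.map f (RingHom.id _) _ _ fun _ => rfl

/-- The map `H₁(S; ℤΓ) → H₁(S; ℤΓ')` induced by a homomorphism `ρ : Γ → Γ'` over `S`. -/
def H₁ℤ.changeCoeff (q : S →* Γ) (q' : S →* Γ') (ρ : Γ →* Γ') (h : ρ.comp q = q') :
    H₁ℤ q →ₛₗ[MonoidAlgebra.mapDomainRingHom ℤ ρ] H₁ℤ q' :=
  H₁.map (MonoidHom.id S) _ _ _ fun s => by simp [← h]

end GroupRing

/-! ## The isomorphism `H₁(G; ℤ[G/N]) ≅ N/[N,N]` -/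

section Relative

variable {G : Type*} [Group G] (N : Subgroup G)

/-- The abelian group `N/[N,N]`, written additively, for a normal subgroup `N` of `G`.  It is a
`ℤ[G/N]`-module by conjugation. -/
def RelAb {G : Type*} [Group G] (N : Subgroup G) : Type _ := Additive (Abelianization N)

instance : AddCommGroup (RelAb N) := inferInstanceAs (AddCommGroup (Additive (Abelianization N)))

namespace RelAb

/-- The class in `N/[N,N]` of an element of `N`. -/
def of (n : N) : RelAb N := Additive.ofMul (Abelianization.of n)

theorem of_mul (m n : N) : of N (m * n) = of N m + of N n := by
  rw [of, map_mul]
  rfl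

theorem of_surjective : Function.Surjective (of N) := by
  intro x
  obtain ⟨n, hn⟩ := QuotientGroup.mk'_surjective (commutator N) (Additive.toMul x)
  exact ⟨n, congrArg Additive.ofMul hn⟩

variable [N.Normal]

/-- The action of `G` on `N/[N,N]` by conjugation. -/
def conj : G →* Module.End ℤ (RelAb N) where
  toFun x := (MonoidHom.toAdditive
    (Abelianization.map (MulAut.conjNormal (H := N) x).toMonoidHom)).toIntLinearMap
  map_one' := by
    ext y
    obtain ⟨n, rfl⟩ := of_surjective N y
    change of N _ = of N n
    simp
  map_mul' a b := by
    ext y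
    obtain ⟨n, rfl⟩ := of_surjective N y
    change of N _ = of N (MulAut.conjNormal a (MulAut.conjNormal b n))
    simp

theorem conj_of (x : G) (n : N) : conj N x (of N n) = of N (MulAut.conjNormal x n) := rfl

/-- The action of `G/N` on `N/[N,N]` by conjugation. -/
def rep : (G ⧸ N) →* Module.End ℤ (RelAb N) :=
  QuotientGroup.lift N (conj N) fun x hx => by
    ext y
    obtain ⟨n, rfl⟩ := of_surjective N y
    have : MulAut.conjNormal x n = ⟨x, hx⟩ * n * ⟨x, hx⟩⁻¹ := by
      ext; simp
    rw [conj_of, this, of_mul, of_mul]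
    change of N _ + _ + -(of N _) = _
    simp

instance : Module (MonoidAlgebra ℤ (G ⧸ N)) (RelAb N) :=
  Module.compHom (RelAb N) (MonoidAlgebra.lift ℤ _ (G ⧸ N) (rep N)).toRingHom

theorem smul_of (x : G) (n : N) :
    MonoidAlgebra.of ℤ (G ⧸ N) (x : G ⧸ N) • of N n = of N (MulAut.conjNormal x n) := by
  change (MonoidAlgebra.lift ℤ _ (G ⧸ N) (rep N)) _ (of N n) = _
  rw [MonoidAlgebra.lift_of]
  rfl

/-- The homomorphism `N/[N,N] → C₁ / d₂(C₂)`, `n ↦ [n]`. -/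
def bracketHom : RelAb N →+ ChainsModBoundaries (groupRingCoeff (QuotientGroup.mk' N)) :=
  MonoidHom.toAdditiveLeft (Abelianization.lift
    { toFun n := Multiplicative.ofAdd (H₁.bracket _ (n : G))
      map_one' := by simp [H₁.bracket_one]
      map_mul' m n := by
        have h : groupRingCoeff (QuotientGroup.mk' N) (m : G) = 1 := by
          rw [MonoidHom.comp_apply, QuotientGroup.mk'_apply, (QuotientGroup.eq_one_iff _).2 m.2,
            map_one]
        rw [Subgroup.coe_mul, H₁.bracket_mul, h, one_smul, add_comm]
        rfl })

theorem bracketHom_of (n : N) : bracketHom N (of N n) = H₁.bracket _ (n : G) := rfl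

theorem bracket_conj (x : G) (n : N) :
    H₁.bracket (groupRingCoeff (QuotientGroup.mk' N)) (MulAut.conjNormal x n : N) =
      MonoidAlgebra.of ℤ (G ⧸ N) (x : G ⧸ N) •
        H₁.bracket (groupRingCoeff (QuotientGroup.mk' N)) (n : G) := by
  have h : groupRingCoeff (QuotientGroup.mk' N) (MulAut.conjNormal x n : N) = 1 := by
    rw [MonoidHom.comp_apply, QuotientGroup.mk'_apply,
      (QuotientGroup.eq_one_iff _).2 (MulAut.conjNormal x n).2, map_one]
  have e : ((MulAut.conjNormal x n : N) : G) * x = x * n := by simp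
  have := congrArg (H₁.bracket (groupRingCoeff (QuotientGroup.mk' N))) e
  rw [H₁.bracket_mul, H₁.bracket_mul, h, one_smul, add_comm] at this
  exact add_right_cancel this

/-- The `ℤ[G/N]`-linear map `N/[N,N] → H₁(G; ℤ[G/N])`, `n ↦ [n]`. -/
def toH₁ : RelAb N →ₗ[MonoidAlgebra ℤ (G ⧸ N)] H₁ℤ (QuotientGroup.mk' N) where
  toFun x := ⟨bracketHom N x, by
    obtain ⟨n, rfl⟩ := of_surjective N x
    rw [LinearMap.mem_ker, bracketHom_of, H₁.d_bracket, MonoidHom.comp_apply,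
      QuotientGroup.mk'_apply, (QuotientGroup.eq_one_iff _).2 n.2, map_one, sub_self]⟩
  map_add' x y := by
    ext1
    exact map_add _ _ _
  map_smul' a x := by
    ext1
    change bracketHom N (a • x) = a • bracketHom N x
    induction a using MonoidAlgebra.induction_on with
    | of γ =>
      obtain ⟨g, rfl⟩ := QuotientGroup.mk_surjective γ
      obtain ⟨n, rfl⟩ := of_surjective N x
      rw [smul_of, bracketHom_of, bracketHom_of, bracket_conj]
    | add a b ha hb => rw [add_smul, add_smul, map_add, ha, hb]
    | smul m a ha => rw [smul_assoc, map_zsmul, ha, smul_assoc]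

theorem toH₁_of (n : N) : toH₁ N (of N n) = H₁.ofKer _ (n : G) (by
    rw [MonoidHom.comp_apply, QuotientGroup.mk'_apply, (QuotientGroup.eq_one_iff _).2 n.2,
      map_one]) := rfl

/-- The element `σ(γ) s σ(γ s̄)⁻¹` of `N`, where `σ : G/N → G` is a set-theoretic section. -/
def transferElt (γ : G ⧸ N) (s : G) : N :=
  ⟨γ.out * s * (γ * (s : G ⧸ N)).out⁻¹, by
    rw [← QuotientGroup.eq_one_iff]
    simp⟩

theorem transferElt_mul (γ : G ⧸ N) (s t : G) :
    transferElt N γ (s * t) = transferElt N γ s * transferElt N (γ * (s : G ⧸ N)) t := by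
  ext
  simp [transferElt, mul_assoc]

/-- The additive extension to `ℤ[G/N]` of a function on `G/N`. -/
def extend {A : Type*} [AddCommGroup A] (v : G ⧸ N → A) : MonoidAlgebra ℤ (G ⧸ N) →+ A :=
  (Finsupp.linearCombination ℤ v).toAddMonoidHom.comp MonoidAlgebra.coeffAddEquiv.toAddMonoidHom

theorem extend_of {A : Type*} [AddCommGroup A] (v : G ⧸ N → A) (γ : G ⧸ N) :
    extend N v (MonoidAlgebra.of ℤ _ γ) = v γ := by
  change Finsupp.linearCombination ℤ v (Finsupp.single γ 1) = _
  simp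

theorem addHom_ext {A : Type*} [AddCommGroup A] {f g : MonoidAlgebra ℤ (G ⧸ N) →+ A}
    (h : ∀ γ, f (MonoidAlgebra.of ℤ _ γ) = g (MonoidAlgebra.of ℤ _ γ)) : f = g := by
  refine AddMonoidHom.ext fun a => ?_
  induction a using MonoidAlgebra.induction_on with
  | of γ => exact h γ
  | add a b ha hb => rw [map_add, map_add, ha, hb]
  | smul m a ha => rw [map_zsmul, map_zsmul, ha]

/-- The additive map `C₁ / d₂(C₂) → N/[N,N]`, `γ[s] ↦ σ(γ) s σ(γ s̄)⁻¹`. -/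
def transfer : ChainsModBoundaries (groupRingCoeff (QuotientGroup.mk' N)) →+ RelAb N :=
  QuotientAddGroup.lift _
    (Finsupp.liftAddHom fun s => extend N fun γ => of N (transferElt N γ s)) (by
      rintro _ ⟨y, rfl⟩
      rw [AddMonoidHom.mem_ker]
      have : (Finsupp.liftAddHom fun s => extend N fun γ => of N (transferElt N γ s)).comp
          (TwistedHomology.d₂ (groupRingCoeff (QuotientGroup.mk' N))).toAddMonoidHom = 0 := by
        refine Finsupp.addHom_ext' fun p => addHom_ext N fun γ => ?_
        obtain ⟨s, t⟩ := p
        simp only [AddMonoidHom.comp_apply, Finsupp.singleAddHom_apply,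
          LinearMap.toAddMonoidHom_coe, TwistedHomology.d₂_single, map_add, map_sub,
          Finsupp.liftAddHom_apply_single, MonoidHom.comp_apply, ← map_mul, extend_of,
          QuotientGroup.mk'_apply, transferElt_mul, of_mul, AddMonoidHom.zero_apply]
        abel
      exact DFunLike.congr_fun this y)

theorem transfer_smul_bracket (γ : G ⧸ N) (s : G) :
    transfer N (MonoidAlgebra.of ℤ _ γ • H₁.bracket _ s) = of N (transferElt N γ s) := by
  rw [H₁.bracket, ← Submodule.Quotient.mk_smul, Finsupp.smul_single, smul_eq_mul, mul_one]
  change Finsupp.liftAddHom (fun s => extend N fun γ => of N (transferElt N γ s)) _ = _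
  rw [Finsupp.liftAddHom_apply_single, extend_of]

theorem transfer_bracket (n : N) : transfer N (H₁.bracket _ (n : G)) = of N n := by
  have h := transfer_smul_bracket N 1 (n : G)
  rw [map_one, one_smul] at h
  rw [h]
  have h1 : ((1 : G ⧸ N).out : G) ∈ N := by
    rw [← QuotientGroup.eq_one_iff]; simp
  have : transferElt N 1 (n : G) = ⟨_, h1⟩ * n * ⟨_, h1⟩⁻¹ := by
    ext
    simp [transferElt, (QuotientGroup.eq_one_iff (n : G)).2 n.2]
  rw [this, of_mul, of_mul]
  change of N _ + _ + -(of N _) = _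
  simp

theorem bracketHom_transfer (x : ChainsModBoundaries (groupRingCoeff (QuotientGroup.mk' N))) :
    bracketHom N (transfer N x) =
      x - extend N (fun γ => H₁.bracket _ γ.out) (ChainsModBoundaries.d _ x) := by
  obtain ⟨y, rfl⟩ := Submodule.Quotient.mk_surjective _ x
  induction y using Finsupp.induction_linear with
  | zero => simp
  | add f g hf hg => rw [Submodule.Quotient.mk_add, map_add, map_add, hf, hg, map_add, map_add]; abel
  | single s a =>
    have e : Finsupp.single s a = a • Finsupp.single s (1 : MonoidAlgebra ℤ (G ⧸ N)) := by simp
    rw [e, Submodule.Quotient.mk_smul]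
    change bracketHom N (transfer N (a • H₁.bracket _ s)) = a • H₁.bracket _ s -
      extend N _ (ChainsModBoundaries.d _ (a • H₁.bracket _ s))
    induction a using MonoidAlgebra.induction_on with
    | of γ =>
      rw [transfer_smul_bracket, bracketHom_of, map_smul, H₁.d_bracket, smul_eq_mul, mul_sub,
        mul_one, MonoidHom.comp_apply, ← map_mul, map_sub, extend_of, extend_of]
      have h : groupRingCoeff (QuotientGroup.mk' N) (transferElt N γ s : G) = 1 := by
        rw [MonoidHom.comp_apply, QuotientGroup.mk'_apply,
          (QuotientGroup.eq_one_iff _).2 (transferElt N γ s).2, map_one]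
      have h' : (transferElt N γ s : G) * (γ * (s : G ⧸ N)).out = γ.out * s := by
        simp [transferElt]
      have := congrArg (H₁.bracket (groupRingCoeff (QuotientGroup.mk' N))) h'
      rw [H₁.bracket_mul, H₁.bracket_mul, h, one_smul, MonoidHom.comp_apply,
        QuotientGroup.mk'_apply, QuotientGroup.out_eq'] at this
      rw [eq_sub_of_add_eq' this, QuotientGroup.mk'_apply]
      abel
    | add a b ha hb =>
      simp only [add_smul, map_add] at ha hb ⊢
      rw [ha (by simp), hb (by simp)]; abel
    | smul m a ha =>
      simp only [smul_assoc, map_zsmul] at ha ⊢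
      rw [ha (by simp), smul_sub]

theorem toH₁_bijective : Function.Bijective (toH₁ N) := by
  constructor
  · intro x y h
    obtain ⟨m, rfl⟩ := of_surjective N x
    obtain ⟨n, rfl⟩ := of_surjective N y
    have := congrArg (fun z => transfer N z.1) h
    simpa [toH₁, bracketHom_of, transfer_bracket] using this
  · rintro ⟨x, hx⟩
    refine ⟨transfer N x, ?_⟩
    ext1
    change bracketHom N (transfer N x) = x
    rw [bracketHom_transfer, LinearMap.mem_ker.1 hx, map_zero, sub_zero]

/-- The isomorphism `H₁(G; ℤ[G/N]) ≅ N/[N,N]`, under which `[n]` corresponds to the class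
of `n`, for `n` in `N`. -/
def equivH₁ : H₁ℤ (QuotientGroup.mk' N) ≃ₗ[MonoidAlgebra ℤ (G ⧸ N)] RelAb N :=
  (LinearEquiv.ofBijective (toH₁ N) (toH₁_bijective N)).symm

end RelAb

end Relative

/-! ## Rational derived series -/

section RationalDerived

variable {G : Type*} [Group G]

/-- The elements of a subgroup `N` that have finite order in `N/[N,N]`. -/
def rationalCommutator (N : Subgroup G) : Subgroup G :=
  ((CommGroup.torsion (Abelianization N)).comap Abelianization.of).map N.subtype

theorem mem_rationalCommutator_iff (N : Subgroup G) (x : G) :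
    x ∈ rationalCommutator N ↔ x ∈ N ∧ ∃ m : ℕ, 0 < m ∧ x ^ m ∈ ⁅N, N⁆ := by
  have key : ∀ y : N, Abelianization.of y = 1 ↔ (y : G) ∈ ⁅N, N⁆ := fun y => by
    rw [← MonoidHom.mem_ker, Abelianization.ker_of, ← Subgroup.map_subtype_commutator]
    simp
  simp only [rationalCommutator, Subgroup.mem_map, Subgroup.mem_comap, CommGroup.mem_torsion,
    isOfFinOrder_iff_pow_eq_one, ← map_pow, key]
  constructor
  · rintro ⟨y, ⟨m, hm, h⟩, rfl⟩
    exact ⟨y.2, m, hm, by simpa using h⟩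
  · rintro ⟨hx, m, hm, h⟩
    exact ⟨⟨x, hx⟩, ⟨m, hm, by simpa using h⟩, rfl⟩

instance (N : Subgroup G) [N.Normal] : (rationalCommutator N).Normal where
  conj_mem x hx g := by
    rw [mem_rationalCommutator_iff] at hx ⊢
    obtain ⟨h, m, hm, hx⟩ := hx
    refine ⟨Subgroup.Normal.conj_mem inferInstance x h g, m, hm, ?_⟩
    rw [conj_pow]
    exact Subgroup.Normal.conj_mem inferInstance _ hx g

variable (G) in
/-- The rational derived series `G_r^(k)`: `G_r^(0) = G`, and `G_r^(k+1)` is the set of `x` in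
`G_r^(k)` with a power `x ^ m`, `m > 0`, in `[G_r^(k), G_r^(k)]`. -/
def rationalDerivedSeries : ℕ → Subgroup G
  | 0 => ⊤
  | k + 1 => rationalCommutator (rationalDerivedSeries k)

instance rationalDerivedSeries_normal : ∀ k, (rationalDerivedSeries G k).Normal
  | 0 => inferInstanceAs (⊤ : Subgroup G).Normal
  | k + 1 =>
    have := rationalDerivedSeries_normal k
    inferInstanceAs (rationalCommutator (rationalDerivedSeries G k)).Normal

theorem derivedSeries_le_rationalDerivedSeries (k : ℕ) :
    derivedSeries G k ≤ rationalDerivedSeries G k := by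
  induction k with
  | zero => exact le_top
  | succ k ih =>
    intro x hx
    have hx' : x ∈ ⁅rationalDerivedSeries G k, rationalDerivedSeries G k⁆ :=
      Subgroup.commutator_mono ih ih hx
    exact (mem_rationalCommutator_iff _ _).2
      ⟨Subgroup.commutator_le_left _ _ hx', 1, one_pos, by simpa using hx'⟩

variable (G) in
/-- The quotient `G_k = G / G_r^(k)`. -/
abbrev RationalQuotient (k : ℕ) : Type _ := G ⧸ rationalDerivedSeries G k

variable (G) in
/-- The projection `G → G_k`. -/
abbrev toRationalQuotient (k : ℕ) : G →* RationalQuotient G k :=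
  QuotientGroup.mk' (rationalDerivedSeries G k)

variable (G) in
/-- The image of `G_r^(k+1)` in `G_r^(k) / [G_r^(k), G_r^(k)]`. -/
def rationalTorsion (k : ℕ) :
    Submodule (MonoidAlgebra ℤ (RationalQuotient G k)) (RelAb (rationalDerivedSeries G k)) where
  carrier := {x | ∃ n : rationalDerivedSeries G k,
    (n : G) ∈ rationalDerivedSeries G (k + 1) ∧ RelAb.of _ n = x}
  zero_mem' := ⟨1, one_mem _, rfl⟩
  add_mem' := by
    rintro _ _ ⟨m, hm, rfl⟩ ⟨n, hn, rfl⟩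
    exact ⟨m * n, mul_mem hm hn, RelAb.of_mul _ _ _⟩
  smul_mem' a x hx := by
    induction a using MonoidAlgebra.induction_on with
    | of γ =>
      obtain ⟨y, rfl⟩ := QuotientGroup.mk_surjective γ
      obtain ⟨n, hn, rfl⟩ := hx
      rw [RelAb.smul_of]
      exact ⟨_, by simpa using (rationalDerivedSeries_normal (G := G) (k + 1)).conj_mem _ hn y, rfl⟩
    | add a b ha hb =>
      obtain ⟨m, hm, ha⟩ := ha
      obtain ⟨n, hn, hb⟩ := hb
      exact ⟨m * n, mul_mem hm hn, by rw [RelAb.of_mul, ha, hb, add_smul]⟩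
    | smul m a ha =>
      obtain ⟨n, hn, ha⟩ := ha
      refine ⟨n ^ m, by simpa using zpow_mem hn m, ?_⟩
      rw [smul_assoc, ← ha]
      exact congrArg Additive.ofMul (map_zpow Abelianization.of n m)

variable (G) in
/-- `G_r^(k) / G_r^(k+1)`, as the quotient of `G_r^(k) / [G_r^(k), G_r^(k)]` by the image of
`G_r^(k+1)`; a module over `ℤ[G_k]` by conjugation. -/
abbrev RationalLayer (k : ℕ) : Type _ :=
  RelAb (rationalDerivedSeries G k) ⧸ rationalTorsion G k

variable (G) in
/-- The composition `H₁(G; ℤG_k) ≅ G_r^(k) / [G_r^(k), G_r^(k)] ↠ G_r^(k) / G_r^(k+1)`. -/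
def toRationalLayer (k : ℕ) :
    H₁ℤ (toRationalQuotient G k) →ₗ[MonoidAlgebra ℤ (RationalQuotient G k)] RationalLayer G k :=
  (rationalTorsion G k).mkQ ∘ₗ (RelAb.equivH₁ (rationalDerivedSeries G k)).toLinearMap

end RationalDerived

/-! ## Algebraic `n`-solutions -/

section AlgebraicSolution

variable {S G : Type*} [Group S] [Group G]

/-- `H₁(S; ℤG_k)`, where `S` acts on `ℤG_k` through `r : S → G`. -/
abbrev SolutionHomology (r : S →* G) (k : ℕ) : Type _ :=
  H₁ℤ ((toRationalQuotient G k).comp r)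

/-- Algebraic `n`-solutions `r : S → G` for a homomorphism `i : F → S` from a free group. -/
structure IsAlgebraicSolution {g : ℕ} (i : FreeGroup (Fin (2 * g)) →* S) (n : ℕ) (r : S →* G) :
    Prop where
  nontrivial : r ≠ 1
  /-- For `k < n`, the map `H₁(S; ℤG_k) → H₁(G; ℤG_k) → G_r^(k) / G_r^(k+1)` is nonzero after
  tensoring with the skew field of fractions of `ℤG_k`. -/
  map_ne_zero : ∀ k < n,
    OreFractionModule.map (toRationalLayer G k ∘ₗ H₁ℤ.map r (toRationalQuotient G k)) ≠ 0
  /-- For `k ≤ n`, the map `H₁(F; ℤG_k) → H₁(S; ℤG_k)` is onto after tensoring with the skew field of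
  fractions of `ℤG_k`. -/
  surjective : ∀ k ≤ n,
    Function.Surjective (OreFractionModule.map (H₁ℤ.map i ((toRationalQuotient G k).comp r)))

/-- The map `S_n = S / S^(n) → G_n = G / G_r^(n)` induced by `r : S → G`. -/
def derivedQuotientMap (r : S →* G) (n : ℕ) : S ⧸ derivedSeries S n →* RationalQuotient G n :=
  QuotientGroup.map _ _ r <| Subgroup.map_le_iff_le_comap.1 <|
    (map_derivedSeries_le_derivedSeries r n).trans (derivedSeries_le_rationalDerivedSeries n)

/-- The composition
`F^(n) → S^(n) / S^(n+1) ≅ H₁(S; ℤS_n) → H₁(S; ℤG_n) → K(G_n) ⊗ H₁(S; ℤG_n)`, with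
`S_n = S / S^(n)` and `K(G_n)` the skew field of fractions of `ℤG_n`. -/
def derivedToHomology {F : Type*} [Group F] (i : F →* S) (r : S →* G) (n : ℕ)
    (w : derivedSeries F n) :
    OreFractionModule (MonoidAlgebra ℤ (RationalQuotient G n)) (SolutionHomology r n) :=
  OreFractionModule.mk _ <|
    H₁ℤ.changeCoeff (QuotientGroup.mk' (derivedSeries S n)) ((toRationalQuotient G n).comp r)
      (derivedQuotientMap r n) rfl <|
      (RelAb.equivH₁ (derivedSeries S n)).symm <|
        RelAb.of _ ⟨i w, map_derivedSeries_le_derivedSeries i n (Subgroup.mem_map_of_mem i w.2)⟩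

end AlgebraicSolution

end

/-!
The proof rests on one computation in the free differential calculus. Let `φ` be an action of the
free group `F` on free generators `x_j` by units of a ring `R` that embeds in a skew field `K`, and
let `a` in `F` act nontrivially and commute in its action with its conjugates. Then the chain
`[⁅a, x_j a x_j⁻¹⁆]` equals `c_j [x_j] + b_j [a]` with
`c_j = (φ a - 1) (1 - φ (x_j a x_j⁻¹))`, which is invertible in `K`
(`H₁.bracket_commutatorElement_conj`). As the `[x_j]` span the one-chains modulo boundaries, the
cycles `z_j = [⁅a, x_j a x_j⁻¹⁆]` span them together with `[a]`, and since `[a]` is not a cycle,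
the `z_j` span precisely the cycles, that is `H₁(F; K)`. This is a proper subspace of a space
spanned by `2g` vectors, so one of the `2g` vectors `z_j` is redundant
(`exists_ker_le_span_image_compl`, `H₁.exists_span_commutatorElement_conj_eq_top`).

The collections are built by induction on `n`. In an algebraic `(n+1)`-solution, some member of
the collection for `n` generates `K ⊗ H₁(S; ℤG_n)`, on which the map to `K ⊗ G_r^(n) / G_r^(n+1)` is
nonzero. So one of its elements `a` has nontrivial image in `G_{n+1}`
(`IsAlgebraicSolution.exists_notMem`). That image lies in the abelian group `G_r^(n) / G_r^(n+1)`, so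
the computation applies, and its result is carried to `S` by the surjection
`K ⊗ H₁(F; ℤG_{n+1}) → K ⊗ H₁(S; ℤG_{n+1})`. Only finitely many pairs (`a`, redundant index) occur, and
they do not depend on the solution.

All of this needs the ring of fractions of `ℤG_n` to be a skew field. The group `G_n` is an iterated
extension of torsion-free abelian groups. Unique products pass through extensions, so `ℤG_n` is
a domain (`uniqueProds_of_ker`); Følner sets do too (`hasFoelnerSets_of_ker`), and with them a count of
dimensions shows that nonzero elements have nonzero common left multiples
(`nonempty_oreSet_monoidAlgebra`).
-/

/-! ### Unique products and Følner sets in group extensions -/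

section GroupExtension

open scoped Pointwise

/-- The unique product property passes from the kernel and the target of a homomorphism to its
source: choose a unique product of the images, and then one in the fibres over its factors,
translated into the kernel. -/
theorem uniqueProds_of_ker {G Q : Type*} [Group G] [Group Q] (f : G →* Q)
    [UniqueProds f.ker] [UniqueProds Q] : UniqueProds G where
  uniqueMul_of_nonempty {A B} hA hB := by
    classical
    obtain ⟨p, hp, q, hq, hpq⟩ :=
      UniqueProds.uniqueMul_of_nonempty (hA.image f) (hB.image f)
    obtain ⟨a₀, ha₀, rfl⟩ := Finset.mem_image.1 hp
    obtain ⟨b₀, hb₀, rfl⟩ := Finset.mem_image.1 hq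
    obtain ⟨u, hu, v, hv, huv⟩ := UniqueProds.uniqueMul_of_nonempty
      (A := A.preimage (fun n : f.ker => a₀ * n) (fun _ _ _ _ h => Subtype.ext (mul_left_cancel h)))
      (B := B.preimage (fun n : f.ker => (n : G) * b₀)
        (fun _ _ _ _ h => Subtype.ext (mul_right_cancel h)))
      ⟨1, Finset.mem_preimage.2 (by simpa using ha₀)⟩ ⟨1, Finset.mem_preimage.2 (by simpa using hb₀)⟩
    replace hu := Finset.mem_preimage.1 hu
    replace hv := Finset.mem_preimage.1 hv
    refine ⟨_, hu, _, hv, fun a b ha hb hab => ?_⟩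
    have hf : f a * f b = f a₀ * f b₀ := by
      rw [← map_mul, hab]
      simp [(MonoidHom.mem_ker).1 u.2, (MonoidHom.mem_ker).1 v.2]
    obtain ⟨h1, h2⟩ := hpq (Finset.mem_image_of_mem f ha) (Finset.mem_image_of_mem f hb) hf
    have hu' : a₀⁻¹ * a ∈ f.ker := by simp [MonoidHom.mem_ker, h1]
    have hv' : b * b₀⁻¹ ∈ f.ker := by simp [MonoidHom.mem_ker, h2]
    obtain ⟨h3, h4⟩ := huv (a := ⟨_, hu'⟩) (b := ⟨_, hv'⟩)
      (Finset.mem_preimage.2 (by simpa using ha)) (Finset.mem_preimage.2 (by simpa using hb))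
      (by
        ext
        simp only [Subgroup.coe_mul]
        calc a₀⁻¹ * a * (b * b₀⁻¹) = a₀⁻¹ * (a * b) * b₀⁻¹ := by group
          _ = u * v := by rw [hab]; group)
    rw [← h3, ← h4]
    simp

/-- A torsion-free abelian group has unique products, since finite subsets generate
free abelian groups. -/
theorem uniqueProds_of_isMulTorsionFree (A : Type*) [CommGroup A] [IsMulTorsionFree A] :
    UniqueProds A where
  uniqueMul_of_nonempty {X Y} hX hY := by
    classical
    let N := Subgroup.closure ((X ∪ Y : Finset A) : Set A)
    have : Group.FG N := inferInstance
    have : Monoid.FG N := Group.fg_iff_monoid_fg.1 this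
    have hXN : ∀ x ∈ X, x ∈ N := fun x hx => Subgroup.subset_closure (by simp [hx])
    have hYN : ∀ x ∈ Y, x ∈ N := fun x hx => Subgroup.subset_closure (by simp [hx])
    obtain ⟨x, hx⟩ := hX
    obtain ⟨y, hy⟩ := hY
    obtain ⟨u, hu, v, hv, huv⟩ := UniqueProds.uniqueMul_of_nonempty
      (A := X.preimage (Subtype.val : N → A) Subtype.val_injective.injOn)
      (B := Y.preimage (Subtype.val : N → A) Subtype.val_injective.injOn)
      ⟨⟨x, hXN x hx⟩, by simpa using hx⟩ ⟨⟨y, hYN y hy⟩, by simpa using hy⟩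
    rw [Finset.mem_preimage] at hu hv
    refine ⟨_, hu, _, hv, fun a b ha hb hab => ?_⟩
    have := huv (a := ⟨a, hXN a ha⟩) (b := ⟨b, hYN b hb⟩) (by simpa using ha) (by simpa using hb)
      (Subtype.ext hab)
    exact ⟨congrArg Subtype.val this.1, congrArg Subtype.val this.2⟩

open Classical in
/-- A form of Følner's condition, in which `E * T` replaces boundaries: every finite set `T` admits
nonempty finite sets `E` for which `E * T` is barely larger than `E`. -/
def HasFoelnerSets (G : Type*) [Group G] : Prop :=
  ∀ (T : Finset G) (c : ℝ), 1 < c → ∃ E : Finset G, E.Nonempty ∧ ((E * T).card : ℝ) ≤ c * E.card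

open Classical in
/-- The powers of a finite subset of a commutative monoid grow polynomially. -/
theorem card_pow_le_of_comm {A : Type*} [CommMonoid A] (T : Finset A) (k : ℕ) :
    (T ^ k).card ≤ (k + 1) ^ T.card := by
  have h : T ^ k ⊆ (Fintype.piFinset fun _ : T => Finset.range (k + 1)).image
      fun (f : T → ℕ) => ∏ t : T, (t : A) ^ f t := by
    induction k with
    | zero =>
      rw [pow_zero, Finset.one_subset, Finset.mem_image]
      exact ⟨fun _ => 0, by simp, by simp⟩
    | succ k ih =>
      rw [pow_succ]
      refine Finset.mul_subset_iff.2 fun x hx t ht => ?_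
      obtain ⟨f, hf, rfl⟩ := Finset.mem_image.1 (ih hx)
      refine Finset.mem_image.2 ⟨f + Pi.single ⟨t, ht⟩ 1, ?_, ?_⟩
      · simp only [Fintype.mem_piFinset, Finset.mem_range, Pi.add_apply] at hf ⊢
        intro a
        have h1 : (Pi.single ⟨t, ht⟩ 1 : T → ℕ) a ≤ 1 := by
          rw [Pi.single_apply]; split_ifs <;> simp
        have := hf a
        omega
      · simp only [Pi.add_apply, pow_add, Finset.prod_mul_distrib]
        congr 1
        rw [Finset.prod_eq_single (⟨t, ht⟩ : T)]
        · simp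
        · intro b _ hb; simp [hb]
        · simp
  refine (Finset.card_le_card h).trans (Finset.card_image_le.trans ?_)
  simp

/-- Abelian groups have Følner sets, since the powers of a finite set grow polynomially. -/
theorem hasFoelnerSets_of_comm (A : Type*) [CommGroup A] : HasFoelnerSets A := by
  classical
  intro T c hc
  by_contra! H
  -- If no power of `insert 1 T` works, then their cardinalities grow exponentially.
  set T' := insert 1 T
  have hne : ∀ k, (T' ^ k).Nonempty := fun k => (Finset.insert_nonempty 1 T).pow
  have hgrow : ∀ k : ℕ, c ^ k ≤ ((T' ^ k).card : ℝ) := by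
    intro k
    induction k with
    | zero => simp
    | succ k ih =>
      have h1 := H (T' ^ k) (hne k)
      have h2 : ((T' ^ k * T).card : ℝ) ≤ (T' ^ (k + 1)).card := by
        rw [pow_succ]
        exact_mod_cast Finset.card_le_card (Finset.mul_subset_mul_left (Finset.subset_insert 1 T))
      calc c ^ (k + 1) = c * c ^ k := pow_succ' c k
        _ ≤ c * (T' ^ k).card := by gcongr
        _ ≤ _ := h1.le.trans h2
  have hlit := (isLittleO_pow_const_const_pow_of_one_lt (R := ℝ) T'.card hc).def
    (show (0 : ℝ) < 1 / (2 * c) by positivity)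
  obtain ⟨n, hn, hn0⟩ := (hlit.and (Filter.eventually_gt_atTop 0)).exists
  obtain ⟨k, rfl⟩ := Nat.exists_eq_succ_of_ne_zero hn0.ne'
  have h3 : c ^ k ≤ ((k + 1 : ℕ) : ℝ) ^ T'.card :=
    (hgrow k).trans (by exact_mod_cast card_pow_le_of_comm T' k)
  have h4 : (0 : ℝ) < c ^ k := by positivity
  rw [Real.norm_of_nonneg (by positivity), Real.norm_of_nonneg (by positivity)] at hn
  have h5 : 1 / (2 * c) * c ^ (k + 1) = c ^ k / 2 := by
    field_simp
    ring
  rw [Nat.succ_eq_add_one, h5] at hn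
  linarith

/-- Følner sets of the kernel and of the target of a surjective homomorphism multiply to Følner
sets of its source. -/
theorem hasFoelnerSets_of_ker {G Q : Type*} [Group G] [Group Q] (f : G →* Q)
    (hf : Function.Surjective f) (hN : HasFoelnerSets f.ker) (hQ : HasFoelnerSets Q) :
    HasFoelnerSets G := by
  classical
  intro T c hc
  have hc' : 1 < √c := by rwa [Real.lt_sqrt zero_le_one, one_pow]
  obtain ⟨EQ, hEQ, hEQc⟩ := hQ (T.image f) _ hc'
  let σ := Function.surjInv hf
  have hσ : ∀ q, f (σ q) = q := Function.surjInv_eq hf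
  -- `τ q t` is the defect of `σ` under right translation: `σ q * t = τ q t * σ (q * f t)`.
  let τ : Q → G → f.ker := fun q t => ⟨σ q * t * (σ (q * f t))⁻¹, by simp [MonoidHom.mem_ker, hσ]⟩
  obtain ⟨EN, hEN, hENc⟩ := hN (Finset.image₂ τ EQ T) _ hc'
  have hcard : ∀ (X : Finset f.ker) (Y : Finset Q),
      (Finset.image₂ (fun (n : f.ker) q => (n : G) * σ q) X Y).card = X.card * Y.card := by
    intro X Y
    refine Finset.card_image₂_iff.2 ?_
    rintro ⟨n, q⟩ - ⟨n', q'⟩ - h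
    have h : (n : G) * σ q = n' * σ q' := h
    have h1 := congrArg f h
    rw [map_mul, map_mul, MonoidHom.mem_ker.1 n.2, MonoidHom.mem_ker.1 n'.2, hσ, hσ, one_mul,
      one_mul] at h1
    subst h1
    rw [mul_left_inj] at h
    rw [Subtype.ext h]
  refine ⟨Finset.image₂ (fun (n : f.ker) q => (n : G) * σ q) EN EQ, hEN.image₂ hEQ, ?_⟩
  have hsub : Finset.image₂ (fun (n : f.ker) q => (n : G) * σ q) EN EQ * T ⊆
      Finset.image₂ (fun (n : f.ker) q => (n : G) * σ q) (EN * Finset.image₂ τ EQ T)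
        (EQ * T.image f) := by
    refine Finset.mul_subset_iff.2 fun x hx t ht => ?_
    obtain ⟨n, hn, q, hq, rfl⟩ := Finset.mem_image₂.1 hx
    refine Finset.mem_image₂.2 ⟨n * τ q t, Finset.mul_mem_mul hn (Finset.mem_image₂_of_mem hq ht),
      q * f t, Finset.mul_mem_mul hq (Finset.mem_image_of_mem f ht), ?_⟩
    simp [τ, mul_assoc]
  calc _ ≤ (((EN * Finset.image₂ τ EQ T).card * (EQ * T.image f).card : ℕ) : ℝ) := by
        rw [← hcard]
        exact_mod_cast Finset.card_le_card hsub
    _ ≤ (√c * EN.card) * (√c * EQ.card) := by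
        rw [Nat.cast_mul]
        gcongr
        refine (le_of_eq ?_).trans hENc
        congr!
    _ = _ := by
        rw [hcard, Nat.cast_mul]
        nth_rewrite 3 [← Real.mul_self_sqrt (by linarith : 0 ≤ c)]
        ring

end GroupExtension

/-! ### Ore domains -/

section Ore

open scoped Pointwise

/-- Tamari's argument: if `E * T` has fewer than `2 * #E` elements, where `T` contains the supports
of `r` and `s`, then `(x, y) ↦ x * r - y * s`, from pairs of elements supported on `E` to elements
supported on `E * T`, has a nonzero kernel. -/
theorem nonempty_oreSet_monoidAlgebra (G : Type*) [Group G] [IsDomain (MonoidAlgebra ℤ G)]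
    (hG : HasFoelnerSets G) :
    Nonempty (OreLocalization.OreSet (nonZeroDivisors (MonoidAlgebra ℤ G))) := by
  classical
  rw [OreLocalization.nonempty_oreSet_iff_of_noZeroDivisors]
  rintro r ⟨s, hs⟩
  rw [mem_nonZeroDivisors_iff_ne_zero] at hs
  set T := r.coeff.support ∪ s.coeff.support
  obtain ⟨E, hE, hEc⟩ := hG T (3 / 2) (by norm_num)
  have hmul : ∀ x ∈ MonoidAlgebra.supported ℤ ℤ (E : Set G), ∀ y : MonoidAlgebra ℤ G,
      y.coeff.support ⊆ T → x * y ∈ MonoidAlgebra.supported ℤ ℤ ((E * T : Finset G) : Set G) := by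
    intro x hx y hy
    rw [MonoidAlgebra.mem_supported, Finset.coe_subset] at hx ⊢
    exact (MonoidAlgebra.support_coeff_mul_subset x y).trans (Finset.mul_subset_mul hx hy)
  let L : (MonoidAlgebra.supported ℤ ℤ (E : Set G)) × (MonoidAlgebra.supported ℤ ℤ (E : Set G)) →ₗ[ℤ]
      MonoidAlgebra.supported ℤ ℤ ((E * T : Finset G) : Set G) :=
    { toFun p := ⟨p.1 * r - p.2 * s, sub_mem (hmul _ p.1.2 r Finset.subset_union_left)
        (hmul _ p.2.2 s Finset.subset_union_right)⟩
      map_add' p q := Subtype.ext <| by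
        simp only [Prod.fst_add, Prod.snd_add, Submodule.coe_add, add_mul]
        abel
      map_smul' a p := Subtype.ext <| by
        simp [mul_sub, mul_assoc] }
  have hrank : ∀ X : Finset G,
      Module.finrank ℤ (MonoidAlgebra.supported ℤ ℤ (X : Set G)) = X.card := by
    intro X
    rw [(MonoidAlgebra.supportedEquivFinsupp (R := ℤ) (S := ℤ) (X : Set G)).finrank_eq]
    simp
  have hfin : ∀ X : Finset G, Module.Finite ℤ (MonoidAlgebra.supported ℤ ℤ (X : Set G)) := fun X =>
    .equiv (MonoidAlgebra.supportedEquivFinsupp (R := ℤ) (S := ℤ) (X : Set G)).symm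
  have hL : ¬ Function.Injective L := by
    intro h
    have h1 := LinearMap.finrank_le_finrank_of_injective h
    rw [Module.finrank_prod, hrank, hrank] at h1
    have h2 : (0 : ℝ) < E.card := by exact_mod_cast hE.card_pos
    have h3 : (E.card : ℝ) + E.card ≤ (E * T).card := by exact_mod_cast h1
    linarith
  obtain ⟨⟨x, y⟩, hxy, hne⟩ : ∃ p, L p = 0 ∧ p ≠ 0 := by
    by_contra! H
    exact hL ((injective_iff_map_eq_zero L).2 H)
  have e : (x : MonoidAlgebra ℤ G) * r = y * s := sub_eq_zero.1 (congrArg Subtype.val hxy)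
  refine ⟨y, ⟨x, mem_nonZeroDivisors_iff_ne_zero.2 fun hx => hne ?_⟩, e⟩
  rw [hx, zero_mul] at e
  have hy := (mul_eq_zero.1 e.symm).resolve_right hs
  exact Prod.ext (Subtype.ext hx) (Subtype.ext hy)

end Ore

/-! ### The group rings of the rational derived quotients -/

section RationalQuotient

/-- The two properties that make an integral group ring an Ore domain pass through extensions with
torsion-free abelian kernel. -/
theorem uniqueProds_and_hasFoelnerSets_of_ker {G Q : Type*} [Group G] [Group Q] (f : G →* Q)
    (hf : Function.Surjective f) (hcomm : ∀ x ∈ f.ker, ∀ y ∈ f.ker, x * y = y * x)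
    (htf : ∀ x ∈ f.ker, ∀ k : ℕ, 0 < k → x ^ k = 1 → x = 1)
    (h : UniqueProds Q ∧ HasFoelnerSets Q) : UniqueProds G ∧ HasFoelnerSets G := by
  let _ : CommGroup f.ker :=
    { (inferInstance : Group f.ker) with
      mul_comm := fun x y => Subtype.ext (hcomm x x.2 y y.2) }
  have : IsMulTorsionFree f.ker := by
    rw [isMulTorsionFree_iff_not_isOfFinOrder]
    rintro ⟨x, hx⟩ hne hfin
    obtain ⟨k, hk, hxk⟩ := isOfFinOrder_iff_pow_eq_one.1 hfin
    exact hne (Subtype.ext (htf x hx k hk (congrArg Subtype.val hxk)))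
  have := h.1
  have : UniqueProds f.ker := uniqueProds_of_isMulTorsionFree _
  exact ⟨uniqueProds_of_ker f, hasFoelnerSets_of_ker f hf (hasFoelnerSets_of_comm _) h.2⟩

variable (G : Type*) [Group G]

theorem rationalDerivedSeries_succ_le (n : ℕ) :
    rationalDerivedSeries G (n + 1) ≤ rationalDerivedSeries G n :=
  fun _ hx => ((mem_rationalCommutator_iff _ _).1 hx).1

theorem commutator_rationalDerivedSeries_le (n : ℕ) :
    ⁅rationalDerivedSeries G n, rationalDerivedSeries G n⁆ ≤ rationalDerivedSeries G (n + 1) :=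
  fun x hx => (mem_rationalCommutator_iff _ _).2
    ⟨Subgroup.commutator_le_left _ _ hx, 1, one_pos, by simpa using hx⟩

/-- `G_n` is obtained from the trivial group by `n` extensions with torsion-free abelian
kernels `G_r^(k) / G_r^(k+1)`. -/
theorem uniqueProds_and_hasFoelnerSets_rationalQuotient (n : ℕ) :
    UniqueProds (RationalQuotient G n) ∧ HasFoelnerSets (RationalQuotient G n) := by
  induction n with
  | zero =>
    have : Subsingleton (RationalQuotient G 0) := QuotientGroup.subsingleton_quotient_top
    let _ : CommGroup (RationalQuotient G 0) :=
      { (inferInstance : Group (RationalQuotient G 0)) with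
        mul_comm := fun _ _ => Subsingleton.elim _ _ }
    have : IsMulTorsionFree (RationalQuotient G 0) := ⟨fun _ _ _ _ _ => Subsingleton.elim _ _⟩
    exact ⟨uniqueProds_of_isMulTorsionFree _, hasFoelnerSets_of_comm _⟩
  | succ n ih =>
    let f : RationalQuotient G (n + 1) →* RationalQuotient G n :=
      QuotientGroup.map _ _ (MonoidHom.id G) (rationalDerivedSeries_succ_le G n)
    have hker : ∀ x : G, (x : RationalQuotient G (n + 1)) ∈ f.ker ↔
        x ∈ rationalDerivedSeries G n := fun x => by
      exact QuotientGroup.eq_one_iff x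
    refine uniqueProds_and_hasFoelnerSets_of_ker f ?_ ?_ ?_ ih
    · intro q
      obtain ⟨x, rfl⟩ := QuotientGroup.mk_surjective q
      exact ⟨x, rfl⟩
    · intro x hx y hy
      obtain ⟨x, rfl⟩ := QuotientGroup.mk_surjective x
      obtain ⟨y, rfl⟩ := QuotientGroup.mk_surjective y
      rw [hker] at hx hy
      rw [← commutatorElement_eq_one_iff_mul_comm]
      exact (QuotientGroup.eq_one_iff _).2 (commutator_rationalDerivedSeries_le G n
        (Subgroup.commutator_mem_commutator hx hy))
    · intro x hx k hk hxk
      obtain ⟨x, rfl⟩ := QuotientGroup.mk_surjective x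
      rw [hker] at hx
      have h1 : x ^ k ∈ rationalDerivedSeries G (n + 1) := (QuotientGroup.eq_one_iff _).1 hxk
      obtain ⟨-, m, hm, h2⟩ := (mem_rationalCommutator_iff _ _).1 h1
      refine (QuotientGroup.eq_one_iff _).2 ((mem_rationalCommutator_iff _ _).2
        ⟨hx, k * m, Nat.mul_pos hk hm, ?_⟩)
      rwa [pow_mul]

instance isDomain_monoidAlgebra_rationalQuotient (n : ℕ) :
    IsDomain (MonoidAlgebra ℤ (RationalQuotient G n)) :=
  have := (uniqueProds_and_hasFoelnerSets_rationalQuotient G n).1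
  inferInstance

/-- `ℤG_n` is an Ore domain. -/
theorem nonempty_oreSet_rationalQuotient (n : ℕ) : Nonempty (OreLocalization.OreSet
    (nonZeroDivisors (MonoidAlgebra ℤ (RationalQuotient G n)))) :=
  nonempty_oreSet_monoidAlgebra _ (uniqueProds_and_hasFoelnerSets_rationalQuotient G n).2

end RationalQuotient

/-! ### Modules of fractions -/

section OreFractions

variable {R : Type*} [Ring R] {M N : Type*} [AddCommGroup M] [Module R M]
  [AddCommGroup N] [Module R N]

namespace OreFractionModule

theorem mk_add (x y : M) : mk R (x + y) = mk R x + mk R y :=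
  OreLocalization.add_oreDiv.symm

theorem mk_zero : mk R (0 : M) = 0 :=
  OreLocalization.zero_oreDiv _

theorem oreDiv_eq_smul_mk (r : R) (x : M) (s : oreDenominators R) :
    (OreLocalization.oreDiv (r • x) s : OreFractionModule R M) =
      (OreLocalization.oreDiv r s : OreFractionRing R) • mk R x :=
  OreLocalization.smul_div_one.symm

theorem mk_smul (r : R) (x : M) :
    mk R (r • x) = (OreLocalization.oreDiv r 1 : OreFractionRing R) • mk R x :=
  oreDiv_eq_smul_mk r x 1

theorem exists_eq_smul_mk (v : OreFractionModule R M) :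
    ∃ (c : OreFractionRing R) (x : M), v = c • mk R x := by
  induction v using OreLocalization.ind with | _ x s
  exact ⟨OreLocalization.oreDiv 1 s, x, by rw [← oreDiv_eq_smul_mk, one_smul]⟩

theorem map_mk (f : M →ₗ[R] N) (x : M) : map f (mk R x) = mk R (f x) := rfl

theorem span_mk_image_eq_top {X : Set M} (hX : Submodule.span R X = ⊤) :
    Submodule.span (OreFractionRing R) (mk R '' X) = ⊤ := by
  refine eq_top_iff.2 fun v _ => ?_
  obtain ⟨c, x, rfl⟩ := exists_eq_smul_mk v
  refine Submodule.smul_mem _ _ ?_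
  have hx : x ∈ Submodule.span R X := hX ▸ Submodule.mem_top
  clear * - hx
  induction hx using Submodule.span_induction with
  | mem x hx => exact Submodule.subset_span ⟨x, hx, rfl⟩
  | zero => rw [mk_zero]; exact zero_mem _
  | add x y _ _ hx hy => rw [mk_add]; exact add_mem hx hy
  | smul r x _ hx => rw [mk_smul]; exact Submodule.smul_mem _ _ hx

/-- Passing to modules of fractions is left exact. -/
theorem map_injective {f : M →ₗ[R] N} (hf : Function.Injective f) :
    Function.Injective (map f) := by
  refine (injective_iff_map_eq_zero _).2 fun v hv => ?_
  induction v using OreLocalization.ind with | _ x s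
  have hv : (OreLocalization.oreDiv (f x) s : OreFractionModule R N) =
      OreLocalization.oreDiv 0 1 := hv.trans OreLocalization.zero_def
  refine Eq.trans ?_ OreLocalization.zero_def.symm
  rw [OreLocalization.oreDiv_eq_iff] at hv ⊢
  obtain ⟨u, r, h, h'⟩ := hv
  refine ⟨u, r, hf ?_, h'⟩
  rw [Submonoid.smul_def, smul_zero, map_zero, map_smul, ← h, Submonoid.smul_def, smul_zero]

end OreFractionModule

variable [IsDomain R] (h : Nonempty (OreLocalization.OreSet (nonZeroDivisors R)))
include h

theorem oreDiv_one_ne_zero {r : R} (hr : r ≠ 0) :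
    (OreLocalization.oreDiv r 1 : OreFractionRing R) ≠ 0 := by
  intro h0
  have h0 : (OreLocalization.oreDiv r 1 : OreFractionRing R) = OreLocalization.oreDiv 0 1 :=
    h0.trans OreLocalization.zero_def
  rw [OreLocalization.oreDiv_eq_iff] at h0
  obtain ⟨u, v, h1, h2⟩ := h0
  rw [Submonoid.smul_def, smul_zero, smul_eq_mul, eq_comm, mul_eq_zero] at h1
  have hv : v = u := by simpa using h2.symm
  have hu : (u : R) ≠ 0 := (mem_oreDenominators_iff R h _).1 u.2
  exact h1.elim (fun h => hu (hv ▸ h)) hr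

theorem OreFractionRing.isUnit_or_eq_zero (c : OreFractionRing R) : IsUnit c ∨ c = 0 := by
  induction c using OreLocalization.ind with | _ r s
  by_cases hr : r = 0
  · right
    rw [hr]
    exact OreLocalization.zero_oreDiv _
  · left
    let t : oreDenominators R := ⟨r, (mem_oreDenominators_iff R h r).2 hr⟩
    exact ⟨⟨OreLocalization.oreDiv (t : R) s, OreLocalization.oreDiv (s : R) t,
      OreLocalization.mul_inv t s, OreLocalization.mul_inv s t⟩, rfl⟩

end OreFractions

/-! ### Linear algebra -/

section LinearAlgebra

/-- If `V` is spanned by vectors `e j` and the kernel of `d` contains vectors `z j` that agree,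
up to nonzero factors, with the `e j` modulo one vector `a` outside the kernel, then the kernel
is spanned by all but one of the `z j`: indeed the span of the `z j` is a complement of the line
through `a`, so it is the kernel, and it has dimension less than the number of the `z j`. -/
theorem exists_ker_le_span_image_compl {K V W ι : Type*} [DivisionRing K] [AddCommGroup V]
    [Module K V] [AddCommGroup W] [Module K W] [Fintype ι] (d : V →ₗ[K] W) (e z : ι → V) (a : V)
    (b c : ι → K) (hz : ∀ j, z j = c j • e j + b j • a) (hc : ∀ j, c j ≠ 0)
    (hdz : ∀ j, d (z j) = 0) (hda : d a ≠ 0) (he : Submodule.span K (Set.range e) = ⊤) :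
    ∃ l, LinearMap.ker d ≤ Submodule.span K (z '' {l}ᶜ) := by
  have hker : LinearMap.ker d = Submodule.span K (Set.range z) := by
    refine le_antisymm (fun v hv => ?_) (Submodule.span_le.2 ?_)
    · have htop : (⊤ : Submodule K V) ≤ Submodule.span K (Set.range z) ⊔ Submodule.span K {a} := by
        rw [← he, Submodule.span_le]
        rintro _ ⟨j, rfl⟩
        have : e j = (c j)⁻¹ • z j + (-((c j)⁻¹ * b j)) • a := by
          rw [hz, smul_add, smul_smul, inv_mul_cancel₀ (hc j), one_smul, smul_smul, neg_smul]
          abel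
        rw [this]
        exact add_mem
          (Submodule.smul_mem _ _ (Submodule.mem_sup_left (Submodule.subset_span ⟨j, rfl⟩)))
          (Submodule.smul_mem _ _
            (Submodule.mem_sup_right (Submodule.mem_span_singleton_self a)))
      obtain ⟨u, hu, w, hw, rfl⟩ := Submodule.mem_sup.1 (htop (Submodule.mem_top (x := v)))
      obtain ⟨k, rfl⟩ := Submodule.mem_span_singleton.1 hw
      have hdu : d u = 0 := by
        have : Submodule.span K (Set.range z) ≤ LinearMap.ker d :=
          Submodule.span_le.2 (by rintro _ ⟨j, rfl⟩; exact hdz j)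
        exact this hu
      rw [LinearMap.mem_ker, map_add, hdu, zero_add, map_smul, smul_eq_zero] at hv
      rw [hv.resolve_right hda, zero_smul, add_zero]
      exact hu
    · rintro _ ⟨j, rfl⟩
      exact hdz j
  have hfin : Module.Finite K V := ⟨⟨(Set.finite_range e).toFinset, by simpa using he⟩⟩
  have hdep : ¬ LinearIndependent K z := by
    intro hli
    have h1 : Module.finrank K V ≤ Fintype.card ι := by
      have := finrank_range_le_card (R := K) e
      rwa [Set.finrank, he, finrank_top] at this
    have h2 := hli.span_eq_top_of_card_eq_finrank' (le_antisymm hli.fintype_card_le_finrank h1)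
    rw [← hker] at h2
    exact hda (h2 ▸ Submodule.mem_top : a ∈ LinearMap.ker d)
  rw [linearIndependent_iff_notMem_span] at hdep
  push Not at hdep
  obtain ⟨l, hl⟩ := hdep
  rw [← Set.compl_eq_univ_sdiff] at hl
  refine ⟨l, ?_⟩
  rw [hker, Submodule.span_le]
  rintro _ ⟨j, rfl⟩
  by_cases hj : j = l
  · rw [hj]; exact hl
  · exact Submodule.subset_span ⟨j, hj, rfl⟩

end LinearAlgebra

/-! ### One-chains of free groups -/

section FreeGroupChains

open scoped commutatorElement

namespace H₁

variable {S R : Type*} [Group S] [Ring R] (φ : S →* R)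

/-- The Fox derivative of a conjugate. In one-chains modulo boundaries, `s ↦ [s]` is the universal
crossed homomorphism, whose values on a free group are the Fox derivatives. -/
theorem bracket_conj_eq (y a : S) :
    bracket φ (y * a * y⁻¹) = (1 - φ (y * a * y⁻¹)) • bracket φ y + φ y • bracket φ a := by
  have h : bracket φ (y * a * y⁻¹ * y) = bracket φ (y * a) := by rw [inv_mul_cancel_right]
  rw [bracket_mul φ (y * a * y⁻¹), bracket_mul φ y] at h
  rw [eq_sub_of_add_eq' h, sub_smul, one_smul]
  abel

theorem map_commutatorElement_eq_one {a b : S} (h : Commute (φ a) (φ b)) : φ ⁅a, b⁆ = 1 := by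
  rw [commutatorElement_def, map_mul, map_mul, map_mul, h.eq, mul_assoc (φ b), ← map_mul φ a,
    mul_inv_cancel, map_one, mul_one, ← map_mul, mul_inv_cancel, map_one]

/-- The Fox derivative of a commutator that acts trivially. -/
theorem bracket_commutatorElement {a b : S} (h : Commute (φ a) (φ b)) :
    bracket φ ⁅a, b⁆ = (1 - φ b) • bracket φ a + (φ a - 1) • bracket φ b := by
  have h1 : bracket φ (⁅a, b⁆ * (b * a)) = bracket φ (a * b) := by
    congr 1
    rw [commutatorElement_def]
    group
  rw [bracket_mul φ ⁅a, b⁆, bracket_mul φ b, bracket_mul φ a,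
    map_commutatorElement_eq_one φ h, one_smul] at h1
  rw [eq_sub_of_add_eq' h1, sub_smul, sub_smul, one_smul, one_smul]
  abel

/-- The Fox derivative of `⁅a, y a y⁻¹⁆`, in terms of those of `y` and `a`. -/
theorem bracket_commutatorElement_conj {a y : S} (h : Commute (φ a) (φ (y * a * y⁻¹))) :
    bracket φ ⁅a, y * a * y⁻¹⁆ =
      ((φ a - 1) * (1 - φ (y * a * y⁻¹))) • bracket φ y +
        (1 - φ (y * a * y⁻¹) + (φ a - 1) * φ y) • bracket φ a := by
  rw [bracket_commutatorElement φ h, bracket_conj_eq φ y a, smul_add, smul_smul, smul_smul,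
    add_smul]
  abel

theorem span_range_bracket_of {α : Type*} (φ : FreeGroup α →* R) :
    Submodule.span R (Set.range fun j => bracket φ (FreeGroup.of j)) = ⊤ := by
  have key : ∀ s, bracket φ s ∈
      Submodule.span R (Set.range fun j => bracket φ (FreeGroup.of j)) := fun s => by
    induction s using FreeGroup.induction_on with
    | C1 => rw [bracket_one]; exact zero_mem _
    | of j => exact Submodule.subset_span ⟨j, rfl⟩
    | inv_of j hj =>
      have h := bracket_mul φ (FreeGroup.of j)⁻¹ (FreeGroup.of j)
      rw [inv_mul_cancel, bracket_one] at h
      rw [eq_neg_of_add_eq_zero_right h.symm]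
      exact neg_mem (Submodule.smul_mem _ _ hj)
    | mul s t hs ht => rw [bracket_mul]; exact add_mem (Submodule.smul_mem _ _ ht) hs
  refine eq_top_iff.2 fun x _ => ?_
  obtain ⟨y, rfl⟩ := Submodule.Quotient.mk_surjective _ x
  induction y using Finsupp.induction_linear with
  | zero => exact zero_mem _
  | add f g hf hg => exact add_mem (hf trivial) (hg trivial)
  | single s a =>
    have e : Finsupp.single s a = a • Finsupp.single s (1 : R) := by simp
    rw [e, Submodule.Quotient.mk_smul]
    exact Submodule.smul_mem _ _ (key s)

/-- Over an Ore domain, if `a` acts nontrivially and commutes in its action with the conjugates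
`x_j a x_j⁻¹` by the generators, then all but one of the commutators `⁅a, x_j a x_j⁻¹⁆` generate
the first homology of the free group over the skew field of fractions. -/
theorem exists_span_commutatorElement_conj_eq_top {α : Type*} [Fintype α] [IsDomain R]
    (hR : Nonempty (OreLocalization.OreSet (nonZeroDivisors R))) (φ : FreeGroup α →* R)
    (a : FreeGroup α) (ha : φ a ≠ 1)
    (hcomm : ∀ j, Commute (φ a) (φ (FreeGroup.of j * a * (FreeGroup.of j)⁻¹))) :
    ∃ l, Submodule.span (OreFractionRing R) ((fun j => OreFractionModule.mk R
      (ofKer φ _ (map_commutatorElement_eq_one φ (hcomm j)))) '' {l}ᶜ) = ⊤ := by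
  have : Nontrivial (OreFractionRing R) :=
    nontrivial_of_ne _ _ (oreDiv_one_ne_zero hR one_ne_zero)
  -- The division ring structure extends the existing ring structure of the localization.
  let _ : DivisionRing (OreFractionRing R) :=
    DivisionRing.ofIsUnitOrEqZero (OreFractionRing.isUnit_or_eq_zero hR)
  let x : α → FreeGroup α := FreeGroup.of
  let ι := (LinearMap.ker (ChainsModBoundaries.d φ)).subtype
  let z : α → H₁ φ := fun j => ofKer φ _ (map_commutatorElement_eq_one φ (hcomm j))
  obtain ⟨l, hl⟩ := exists_ker_le_span_image_compl (K := OreFractionRing R)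
    (OreFractionModule.map (ChainsModBoundaries.d φ))
    (fun j => OreFractionModule.mk R (bracket φ (x j)))
    (fun j => OreFractionModule.map ι (OreFractionModule.mk R (z j)))
    (OreFractionModule.mk R (bracket φ a))
    (fun j => OreLocalization.oreDiv (1 - φ (x j * a * (x j)⁻¹) + (φ a - 1) * φ (x j)) 1)
    (fun j => OreLocalization.oreDiv ((φ a - 1) * (1 - φ (x j * a * (x j)⁻¹))) 1)
    (fun j => by
      rw [OreFractionModule.map_mk, ← OreFractionModule.mk_smul, ← OreFractionModule.mk_smul,
        ← OreFractionModule.mk_add, ← bracket_commutatorElement_conj φ (hcomm j)]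
      rfl)
    (fun j => oreDiv_one_ne_zero hR (mul_ne_zero (sub_ne_zero.2 ha) (sub_ne_zero.2 fun h => ha (by
      have h1 : φ a = φ ((x j)⁻¹ * (x j * a * (x j)⁻¹) * x j) := by
        congr 1
        group
      rw [h1, map_mul, map_mul, ← h, mul_one, ← map_mul, inv_mul_cancel, map_one]))))
    (fun j => by
      rw [OreFractionModule.map_mk, OreFractionModule.map_mk, ← OreFractionModule.mk_zero]
      exact congrArg _ (LinearMap.mem_ker.1 (z j).2))
    (by
      rw [OreFractionModule.map_mk, d_bracket]
      exact oreDiv_one_ne_zero hR (sub_ne_zero.2 ha))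
    (by
      have := OreFractionModule.span_mk_image_eq_top (span_range_bracket_of φ)
      rwa [← Set.range_comp] at this)
  refine ⟨l, eq_top_iff.2 fun v _ => ?_⟩
  have hv : OreFractionModule.map ι v ∈ LinearMap.ker
      (OreFractionModule.map (ChainsModBoundaries.d φ)) := by
    obtain ⟨c, y, rfl⟩ := OreFractionModule.exists_eq_smul_mk v
    rw [map_smul]
    refine Submodule.smul_mem _ _ ?_
    rw [LinearMap.mem_ker, OreFractionModule.map_mk, OreFractionModule.map_mk,
      ← OreFractionModule.mk_zero]
    exact congrArg _ (LinearMap.mem_ker.1 y.2)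
  have hv' := hl hv
  have himage : (fun j => OreFractionModule.map ι (OreFractionModule.mk R (z j))) '' {l}ᶜ =
      OreFractionModule.map ι '' ((fun j => OreFractionModule.mk R (z j)) '' {l}ᶜ) := by
    rw [Set.image_image]
  rw [himage, Submodule.span_image] at hv'
  obtain ⟨v', h1, h2⟩ := hv'
  rwa [← OreFractionModule.map_injective Subtype.val_injective h2]

end H₁

end FreeGroupChains

/-! ### Derived subgroups of free groups -/

/-- A free group of rank at least two is not solvable, as it maps onto the symmetric group of
degree five. -/
theorem FreeGroup.not_isSolvable {α : Type*} [Nontrivial α] : ¬ Group.IsSolvable (FreeGroup α) := by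
  classical
  intro h
  obtain ⟨a, b, hab⟩ := exists_pair_ne α
  let σ : Equiv.Perm (Fin 5) := finRotate 5
  let f : FreeGroup α →* Equiv.Perm (Fin 5) :=
    FreeGroup.lift fun x => if x = a then σ else Equiv.swap 0 (σ 0)
  have hf : Function.Surjective f := by
    rw [← MonoidHom.range_eq_top, eq_top_iff, ← Equiv.Perm.closure_cycle_adjacent_swap
      (σ := σ) isCycle_finRotate support_finRotate 0, Subgroup.closure_le]
    rintro _ (rfl | rfl)
    · exact ⟨FreeGroup.of a, by simp [f]⟩
    · exact ⟨FreeGroup.of b, by simp [f, hab.symm]⟩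
  exact Equiv.Perm.not_isSolvable_fin_5 (Group.isSolvable_of_surjective hf)

theorem FreeGroup.infinite_derivedSeries {α : Type*} [Nontrivial α] (n : ℕ) :
    Infinite (derivedSeries (FreeGroup α) n) := by
  have hne : derivedSeries (FreeGroup α) n ≠ ⊥ := fun h =>
    FreeGroup.not_isSolvable (α := α) ⟨n, h⟩
  obtain ⟨w, hw⟩ := Subgroup.ne_bot_iff_exists_ne_one.1 hne
  exact Infinite.of_injective (fun k : ℕ => w ^ k)
    (injective_pow_iff_not_isOfFinOrder.2 (not_isOfFinOrder_of_isMulTorsionFree hw))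

/-! ### Algebraic solutions -/

section Solutions

open scoped commutatorElement

variable {S G F : Type*} [Group S] [Group G] [Group F]

theorem groupRingCoeff_eq_one_iff (n : ℕ) (q : S →* RationalQuotient G n) (s : S) :
    groupRingCoeff q s = 1 ↔ q s = 1 := by
  rw [MonoidHom.comp_apply, ← map_one (MonoidAlgebra.of ℤ (RationalQuotient G n))]
  exact MonoidAlgebra.of_injective.eq_iff

theorem map_mem_rationalDerivedSeries (f : F →* G) {n : ℕ} {w : F} (hw : w ∈ derivedSeries F n) :
    f w ∈ rationalDerivedSeries G n :=
  derivedSeries_le_rationalDerivedSeries n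
    (map_derivedSeries_le_derivedSeries f n (Subgroup.mem_map_of_mem f hw))

theorem groupRingCoeff_derivedSeries (f : F →* G) (n : ℕ) (w : derivedSeries F n) :
    groupRingCoeff ((toRationalQuotient G n).comp f) (w : F) = 1 :=
  (groupRingCoeff_eq_one_iff n _ _).2
    ((QuotientGroup.eq_one_iff _).2 (map_mem_rationalDerivedSeries f w.2))

theorem H₁.map_ofKer {R R' : Type*} [Ring R] [Ring R'] (f : F →* S) (σ : R →+* R') (φ : F →* R)
    (φ' : S →* R') (h : ∀ s, σ (φ s) = φ' (f s)) (w : F) (hw : φ w = 1) :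
    H₁.map f σ φ φ' h (H₁.ofKer φ w hw) =
      H₁.ofKer φ' (f w) ((h w).symm.trans (hw ▸ map_one σ)) :=
  Subtype.ext (H₁.chainMap_bracket f σ φ φ' h w)

theorem H₁ℤ.map_ofKer {Γ : Type*} [Group Γ] (f : F →* S) (q : S →* Γ) (w : F)
    (hw : groupRingCoeff (q.comp f) w = 1) :
    H₁ℤ.map f q (H₁.ofKer _ w hw) = H₁.ofKer (groupRingCoeff q) (f w) hw :=
  H₁.map_ofKer f (RingHom.id _) (groupRingCoeff (q.comp f)) _ (fun _ => rfl) w hw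

/-- The map `F^(n) → K ⊗ H₁(S; ℤG_n)` factors through `K ⊗ H₁(F; ℤG_n)`. -/
theorem derivedToHomology_eq_map (i : F →* S) (r : S →* G) (n : ℕ) (w : derivedSeries F n) :
    derivedToHomology i r n w =
      OreFractionModule.map (H₁ℤ.map i ((toRationalQuotient G n).comp r))
        (OreFractionModule.mk _ (H₁.ofKer _ (w : F) (groupRingCoeff_derivedSeries (r.comp i) n w))) := by
  rw [OreFractionModule.map_mk, H₁ℤ.map_ofKer]
  have hw : groupRingCoeff (QuotientGroup.mk' (derivedSeries S n)) (i w) = 1 := by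
    rw [MonoidHom.comp_apply, QuotientGroup.mk'_apply, (QuotientGroup.eq_one_iff _).2
      (map_derivedSeries_le_derivedSeries i n (Subgroup.mem_map_of_mem i w.2)), map_one]
  exact congrArg (OreFractionModule.mk _) (H₁.map_ofKer (MonoidHom.id S)
    (MonoidAlgebra.mapDomainRingHom ℤ (derivedQuotientMap r n))
    (groupRingCoeff (QuotientGroup.mk' (derivedSeries S n))) _ (fun s => by
      simp [derivedQuotientMap]) (i w) hw)

theorem span_derivedToHomology_eq_top {i : F →* S} {r : S →* G} {n : ℕ}
    (hsurj : Function.Surjective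
      (OreFractionModule.map (H₁ℤ.map i ((toRationalQuotient G n).comp r))))
    {X : Set (derivedSeries F n)}
    (hX : Submodule.span (OreFractionRing (MonoidAlgebra ℤ (RationalQuotient G n)))
      ((fun w : derivedSeries F n => OreFractionModule.mk (MonoidAlgebra ℤ (RationalQuotient G n))
        (H₁.ofKer _ (w : F) (groupRingCoeff_derivedSeries (r.comp i) n w))) '' X) = ⊤) :
    Submodule.span (OreFractionRing (MonoidAlgebra ℤ (RationalQuotient G n)))
      (derivedToHomology i r n '' X) = ⊤ := by
  have h := congrArg
    (Submodule.map (OreFractionModule.map (H₁ℤ.map i ((toRationalQuotient G n).comp r)))) hX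
  rw [Submodule.map_span, Set.image_image, Submodule.map_top, LinearMap.range_eq_top.2 hsurj] at h
  rw [← h]
  congr 1
  exact Set.image_congr fun w _ => derivedToHomology_eq_map i r n w

/-- The image of `w` in `K ⊗ G_r^(n) / G_r^(n+1)` vanishes if `r (i w)` lies in `G_r^(n+1)`. -/
theorem map_toRationalLayer_derivedToHomology {i : F →* S} {r : S →* G} {n : ℕ}
    (w : derivedSeries F n) (hw : r (i w) ∈ rationalDerivedSeries G (n + 1)) :
    OreFractionModule.map (toRationalLayer G n ∘ₗ H₁ℤ.map r (toRationalQuotient G n))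
      (derivedToHomology i r n w) = 0 := by
  rw [derivedToHomology_eq_map, OreFractionModule.map_mk, OreFractionModule.map_mk,
    ← OreFractionModule.mk_zero]
  congr 1
  have hw' := groupRingCoeff_derivedSeries (r.comp i) n w
  have h : H₁ℤ.map r (toRationalQuotient G n)
      (H₁ℤ.map i ((toRationalQuotient G n).comp r) (H₁.ofKer _ (w : F) hw')) =
      RelAb.toH₁ (rationalDerivedSeries G n)
        (RelAb.of _ ⟨r (i w), map_mem_rationalDerivedSeries (r.comp i) w.2⟩) := by
    rw [H₁ℤ.map_ofKer, H₁ℤ.map_ofKer]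
    rfl
  refine (congrArg (toRationalLayer G n) h).trans ?_
  refine (congrArg (rationalTorsion G n).mkQ
    ((RelAb.equivH₁ (rationalDerivedSeries G n)).apply_symm_apply _)).trans ?_
  exact (Submodule.Quotient.mk_eq_zero _).2 ⟨_, hw, rfl⟩

theorem IsAlgebraicSolution.of_succ {g : ℕ} {i : FreeGroup (Fin (2 * g)) →* S} {n : ℕ}
    {r : S →* G} (h : IsAlgebraicSolution i (n + 1) r) : IsAlgebraicSolution i n r where
  nontrivial := h.nontrivial
  map_ne_zero k hk := h.map_ne_zero k (by omega)
  surjective k hk := h.surjective k (by omega)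

/-- In an algebraic `(n+1)`-solution, every generating set of `K ⊗ H₁(S; ℤG_n)` contains an element
that survives in `G_{n+1}`. -/
theorem IsAlgebraicSolution.exists_notMem {g : ℕ} {i : FreeGroup (Fin (2 * g)) →* S} {n : ℕ}
    {r : S →* G} (h : IsAlgebraicSolution i (n + 1) r)
    {X : Set (derivedSeries (FreeGroup (Fin (2 * g))) n)}
    (hX : Submodule.span (OreFractionRing (MonoidAlgebra ℤ (RationalQuotient G n)))
      (derivedToHomology i r n '' X) = ⊤) :
    ∃ a ∈ X, r (i a) ∉ rationalDerivedSeries G (n + 1) := by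
  by_contra! H
  refine h.map_ne_zero n n.lt_succ_self (LinearMap.ext_on_range (v := fun w : X =>
    derivedToHomology i r n w) ?_ fun w => ?_)
  · rw [← hX, Set.image_eq_range]
  · exact map_toRationalLayer_derivedToHomology _ (H w w.2)

/-- The commutator `⁅a, x_j a x_j⁻¹⁆` of `a` with a conjugate by a generator of the free group. -/
def commutatorConj {α : Type*} {n : ℕ} (a : derivedSeries (FreeGroup α) n) (j : α) :
    derivedSeries (FreeGroup α) (n + 1) :=
  ⟨⁅(a : FreeGroup α), FreeGroup.of j * a * (FreeGroup.of j)⁻¹⁆,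
    Subgroup.commutator_mem_commutator a.2 ((derivedSeries_normal _ n).conj_mem _ a.2 _)⟩

theorem IsAlgebraicSolution.exists_span_commutatorConj_eq_top {g : ℕ}
    {i : FreeGroup (Fin (2 * g)) →* S} {n : ℕ} {r : S →* G} (h : IsAlgebraicSolution i (n + 1) r)
    (a : derivedSeries (FreeGroup (Fin (2 * g))) n)
    (ha : r (i a) ∉ rationalDerivedSeries G (n + 1)) :
    ∃ l, Submodule.span (OreFractionRing (MonoidAlgebra ℤ (RationalQuotient G (n + 1))))
      (derivedToHomology i r (n + 1) '' (commutatorConj a '' {l}ᶜ)) = ⊤ := by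
  have hcomm : ∀ b ∈ derivedSeries (FreeGroup (Fin (2 * g))) n, Commute
      (groupRingCoeff ((toRationalQuotient G (n + 1)).comp (r.comp i)) a)
      (groupRingCoeff ((toRationalQuotient G (n + 1)).comp (r.comp i)) b) := by
    intro b hb
    refine Commute.map (x := toRationalQuotient G (n + 1) (r (i a)))
      (y := toRationalQuotient G (n + 1) (r (i b)))
      (commutatorElement_eq_one_iff_commute.1 ?_) (MonoidAlgebra.of ℤ (RationalQuotient G (n + 1)))
    exact (QuotientGroup.eq_one_iff _).2 (commutator_rationalDerivedSeries_le G n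
      (Subgroup.commutator_mem_commutator (map_mem_rationalDerivedSeries (r.comp i) a.2)
        (map_mem_rationalDerivedSeries (r.comp i) hb)))
  obtain ⟨l, hl⟩ := H₁.exists_span_commutatorElement_conj_eq_top
    (nonempty_oreSet_rationalQuotient G (n + 1)) _ (a : FreeGroup (Fin (2 * g)))
    (fun h1 => ha ((QuotientGroup.eq_one_iff _).1 ((groupRingCoeff_eq_one_iff (n + 1) _ _).1 h1)))
    (fun j => hcomm _ ((derivedSeries_normal _ n).conj_mem _ a.2 (FreeGroup.of j)))
  refine ⟨l, span_derivedToHomology_eq_top (h.surjective _ le_rfl) ?_⟩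
  rw [Set.image_image]
  exact hl

/-- `K ⊗ H₁(S; ℤG_0) = H₁(S; ℚ)` is generated by the images of the generators of the free group. -/
theorem IsAlgebraicSolution.span_zero_eq_top {g : ℕ} {i : FreeGroup (Fin (2 * g)) →* S}
    {r : S →* G} (h : IsAlgebraicSolution i 0 r) :
    Submodule.span (OreFractionRing (MonoidAlgebra ℤ (RationalQuotient G 0)))
      (derivedToHomology i r 0 '' Set.range fun j =>
        (⟨FreeGroup.of j, Subgroup.mem_top _⟩ : derivedSeries _ 0)) = ⊤ := by
  refine span_derivedToHomology_eq_top (h.surjective 0 le_rfl) ?_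
  rw [← Set.image_univ, Set.image_image, ← Set.image_image (OreFractionModule.mk _)]
  refine OreFractionModule.span_mk_image_eq_top (eq_top_iff.2 fun x _ => ?_)
  have hx := (H₁.span_range_bracket_of
    (groupRingCoeff ((toRationalQuotient G 0).comp (r.comp i)))).ge (Submodule.mem_top (x := x.1))
  rw [Set.image_univ]
  have hrange : (Set.range fun j => H₁.bracket
      (groupRingCoeff ((toRationalQuotient G 0).comp (r.comp i))) (FreeGroup.of j)) =
      (LinearMap.ker (ChainsModBoundaries.d _)).subtype '' Set.range fun j =>
        H₁.ofKer _ (FreeGroup.of j)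
          (groupRingCoeff_derivedSeries (r.comp i) 0 ⟨_, Subgroup.mem_top _⟩) := by
    rw [← Set.range_comp]
    rfl
  rw [hrange, Submodule.span_image] at hx
  obtain ⟨y, hy, hyx⟩ := hx
  rwa [← Subtype.ext hyx]

end Solutions

theorem theorem6p4 {S : Type*} [Group S] (hS : Nontrivial (H₁ (1 : S →* ℚ)))
    (g : ℕ) (i : FreeGroup (Fin (2 * g)) →* S) (n : ℕ) :
    ∃ P : Finset (Finset (derivedSeries (FreeGroup (Fin (2 * g))) n)),
      (∀ T ∈ P, if n = 0 then T.card = 2 * g else T.card + 1 = 2 * g) ∧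
      ∀ {G : Type*} [Group G] (r : S →* G), IsAlgebraicSolution i n r →
        ∃ T ∈ P, Submodule.span (OreFractionRing (MonoidAlgebra ℤ (RationalQuotient G n)))
          (derivedToHomology i r n '' T) = ⊤ := by
  classical
  induction n with
  | zero =>
    refine ⟨{Finset.univ.image fun j => ⟨FreeGroup.of j, Subgroup.mem_top _⟩}, ?_, ?_⟩
    · intro T hT
      rw [Finset.mem_singleton.1 hT, if_pos rfl, Finset.card_image_of_injective, Finset.card_univ,
        Fintype.card_fin]
      exact fun j k hjk => FreeGroup.of_injective (congrArg Subtype.val hjk)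
    · intro G _ r hr
      refine ⟨_, Finset.mem_singleton_self _, ?_⟩
      rw [Finset.coe_image, Finset.coe_univ, Set.image_univ]
      exact hr.span_zero_eq_top
  | succ n ih =>
    obtain ⟨P, -, hP⟩ := ih
    -- The commutators with `j ≠ l` need not be distinct a priori, so they are completed to a set of
    -- the right size; this is possible since the derived subgroup is infinite.
    have hT : ∀ (a : derivedSeries (FreeGroup (Fin (2 * g))) n) (l : Fin (2 * g)),
        ∃ T : Finset (derivedSeries (FreeGroup (Fin (2 * g))) (n + 1)),
          (Finset.univ.erase l).image (commutatorConj a) ⊆ T ∧ T.card = 2 * g - 1 := by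
      intro a l
      have : Nontrivial (Fin (2 * g)) := Fin.nontrivial_iff_two_le.2 (by have := l.2; omega)
      have := FreeGroup.infinite_derivedSeries (α := Fin (2 * g)) (n + 1)
      refine Infinite.exists_superset_card_eq _ _ (Finset.card_image_le.trans ?_)
      rw [Finset.card_erase_of_mem (Finset.mem_univ l), Finset.card_univ, Fintype.card_fin]
    choose T hTsub hTcard using hT
    refine ⟨Finset.image₂ T (P.biUnion id) Finset.univ, ?_, ?_⟩
    · intro U hU
      obtain ⟨a, -, l, -, rfl⟩ := Finset.mem_image₂.1 hU
      rw [if_neg n.succ_ne_zero, hTcard]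
      have := l.2
      omega
    · intro G _ r hr
      obtain ⟨U, hU, hspan⟩ := hP r hr.of_succ
      obtain ⟨a, haU, ha⟩ := hr.exists_notMem hspan
      obtain ⟨l, hl⟩ := hr.exists_span_commutatorConj_eq_top a ha
      refine ⟨T a l, Finset.mem_image₂_of_mem (Finset.mem_biUnion.2 ⟨U, hU, haU⟩)
        (Finset.mem_univ l), eq_top_iff.2 (hl.ge.trans (Submodule.span_mono (Set.image_mono ?_)))⟩
      rintro _ ⟨j, hj, rfl⟩
      exact hTsub a l (Finset.mem_image_of_mem _ (Finset.mem_erase.2 ⟨hj, Finset.mem_univ j⟩))
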